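/- **Theorem (Soundness of Amida nets).** Formulas are those of IMLL with unit, $\varphi ::= \mathbf 1\mid X\mid\varphi\otimes\varphi\mid\varphi\multimap\varphi$ ($X$ from a countably infinite set). A hypersequent $\mathcal H$ is a finite sequence of components $\Gamma\vdash\varphi$, with $\Gamma$ a finite sequence of formulas. *Derivable* means derivable by the following rules, where $\mathcal O,\mathcal O'$ are arbitrary hypersequents: - (Ax) $\varphi\vdash\varphi$; ($\mathbf 1$R) $\vdash\mathbf 1$; (Merge) from $\mathcal O$ and $\mathcal O'$ infer $\mathcal O\mid\mathcal O'$; - exchange of neighbouring formulas in the context of the last component, and of neighbouring components; - (Cut) from $\mathcal O\mid\Gamma\vdash\varphi\mid\varphi,\Delta\vdash\psi$ infer $\mathcal O\mid\Gamma,\Delta\vdash\psi$; - ($\mathbf 1$L) from $\mathcal O\mid\Gamma\vdash\varphi$ infer $\mathcal O\mid\Gamma,\mathbf 1\vdash\varphi$; - ($\otimes$R) from $\mathcal O\mid\Gamma\vdash\varphi\mid\Delta\vdash\psi$ infer $\mathcal O\mid\Gamma,\Delta\vdash\varphi\otimes\psi$; ($\otimes$L) from $\mathcal O\mid\Gamma,\varphi,\psi\vdash\theta$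 infer $\mathcal O\mid\Gamma,\varphi\otimes\psi\vdash\theta$; - ($\multimap$R) from $\mathcal O\mid\Gamma,\varphi\vdash\psi$ infer $\mathcal O\mid\Gamma\vdash\varphi\multimap\psi$; ($\multimap$L) from $\mathcal O\mid\Gamma\vdash\varphi\mid\psi,\Delta\vdash\theta$ infer $\mathcal O\mid\Gamma,\varphi\multimap\psi,\Delta\vdash\theta$; - (Sync) from $\mathcal O\mid\Gamma\vdash\varphi\mid\Delta\vdash\psi$ infer $\mathcal O\mid\Gamma\vdash\psi\mid\Delta\vdash\varphi$. *Trees.* A nonempty hypersequent is read as the formula $\bigotimes_i(\bigotimes\Gamma_i\multimap\varphi_i)$ (with $\varphi_i$ for an empty $\Gamma_i$). A formula and a polarity give a polarized formula by $\mathbf 1^+=\mathbf 1^+$, $\mathbf 1^-=\bot^-$, $X^\pm=X^\pm$, $(\varphi\multimap\psi)^+=\varphi^-⅋^+\psi^+$, $(\varphi\multimap\psi)^-=\varphi^+\otimes^-\psi^-$, $(\varphi\otimes\psi)^+=\varphi^+\otimes^+\psi^+$, $(\varphi\otimes\psi)^-=\varphi^-⅋^-\psi^-$, and this is viewed as its syntax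 tree. Into every positive node an *up-edge* leads from below (from its parent; for the root it is the conclusion edge). A $\otimes^+$-node is thus followed by the up-edges to both its children, a $⅋^+$-node by the up-edge to its right child only (its left child is its *dashed child*), and a $\otimes^-$-node by the up-edge to its left child. Down-edges lead to a $\otimes^-$-node from its right child and to a $⅋^-$-node from both children. *Essential nets.* An essential net of $\mathcal H$ consists of the tree of the positive translation of $\mathcal H$, finitely many cuts (each given by trees of $\psi^-$ and $\psi^+$ and an up-edge from the root of the former to the root of the latter), a set of directed axiom edges from positive to negative leaves, and finitely many $\bot$-branches: points that subdivide an up-edge into two, from which a further edge leads to a $\bot^-$-leaf. *Amida nets.* The Amida nets of $\mathcal H$ are obtained from its essential nets by finitely many additions of *Amida edges*: either subdivide two different up-edges (possibly pieces of one original edge), $e_0$ into $e_{0d},e_{0u}$ and $e_1$ into $e_{1d},e_{1u}$ (lower, upper), and join the two new points by an Amida edge $e_a$, paths now running $e_{0d}e_ae_{1u}$ and $e_{1d}e_ae_{0u}$; or subdivide one up-edge by two points into $e_d,e_m,e_u$ and join these points by $e_a$, paths now running $e_de_ae_u$ and $\cdots e_me_ae_me_a\cdots$. Paths follow the directed edges,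 cross every Amida edge they meet, and never use the line between a $⅋^+$-node and its dashed child. *Correctness.* An Amida net is correct if 1. every leaf $X^+$ has exactly one outgoing axiom edge and it leads to a leaf $X^-$; every leaf $X^-$ has exactly one incoming axiom edge and it comes from a leaf $X^+$; every leaf $\bot^-$ is connected to a $\bot$-branch; no axiom edge is attached to a leaf $\mathbf 1^+$; 2. there is no directed cycle (paths being continued across Amida edges as above); 3. for every $⅋^+$-node $p$, every path from the root (starting at the bottom of the conclusion edge) that reaches the dashed child of $p$ passes through $p$. Then: if a nonempty hypersequent $\mathcal H$ has a correct Amida net, $\mathcal H$ is derivable. -/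

import Mathlib

namespace Amida

/-! ### Formulas, hypersequents and derivability -/

/-- Formulas of IMLL with unit, over the countably infinite set `ℕ` of propositional variables. -/
inductive Formula : Type
  | one : Formula
  | var (X : ℕ) : Formula
  | tensor (φ ψ : Formula) : Formula
  | lolli (φ ψ : Formula) : Formula

/-- A component `Γ ⊢ φ` of a hypersequent; contexts are finite sequences. -/
structure Sequent : Type where
  ctx : List Formula
  concl : Formula

infix:50 " ⊢ₛ " => Sequent.mk

/-- A hypersequent is a finite sequence of components, read conjunctively. -/
abbrev Hypersequent : Type := List Sequent

/-- Derivability in the multiplicative part of the hypersequent calculus (terms erased). -/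
inductive Derivable : Hypersequent → Prop
  | ax (φ : Formula) : Derivable [[φ] ⊢ₛ φ]
  | merge (O O' : Hypersequent) : Derivable O → Derivable O' → Derivable (O ++ O')
  | cut (O : Hypersequent) (Γ Δ : List Formula) (φ ψ : Formula) :
      Derivable (O ++ [Γ ⊢ₛ φ, (φ :: Δ) ⊢ₛ ψ]) → Derivable (O ++ [(Γ ++ Δ) ⊢ₛ ψ])
  | internalExchange (O : Hypersequent) (Γ Δ : List Formula) (φ ψ θ : Formula) :
      Derivable (O ++ [(Γ ++ φ :: ψ :: Δ) ⊢ₛ θ]) → Derivable (O ++ [(Γ ++ ψ :: φ :: Δ) ⊢ₛ θ])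
  | externalExchange (O O' : Hypersequent) (Γ Δ : List Formula) (φ ψ : Formula) :
      Derivable (O ++ [Γ ⊢ₛ φ, Δ ⊢ₛ ψ] ++ O') → Derivable (O ++ [Δ ⊢ₛ ψ, Γ ⊢ₛ φ] ++ O')
  | oneR : Derivable [[] ⊢ₛ Formula.one]
  | oneL (O : Hypersequent) (Γ : List Formula) (φ : Formula) :
      Derivable (O ++ [Γ ⊢ₛ φ]) → Derivable (O ++ [(Γ ++ [Formula.one]) ⊢ₛ φ])
  | tensorR (O : Hypersequent) (Γ Δ : List Formula) (φ ψ : Formula) :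
      Derivable (O ++ [Γ ⊢ₛ φ, Δ ⊢ₛ ψ]) → Derivable (O ++ [(Γ ++ Δ) ⊢ₛ φ.tensor ψ])
  | tensorL (O : Hypersequent) (Γ : List Formula) (φ ψ θ : Formula) :
      Derivable (O ++ [(Γ ++ [φ, ψ]) ⊢ₛ θ]) → Derivable (O ++ [(Γ ++ [φ.tensor ψ]) ⊢ₛ θ])
  | lolliR (O : Hypersequent) (Γ : List Formula) (φ ψ : Formula) :
      Derivable (O ++ [(Γ ++ [φ]) ⊢ₛ ψ]) → Derivable (O ++ [Γ ⊢ₛ φ.lolli ψ])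
  | lolliL (O : Hypersequent) (Γ Δ : List Formula) (φ ψ θ : Formula) :
      Derivable (O ++ [Γ ⊢ₛ φ, (ψ :: Δ) ⊢ₛ θ]) →
        Derivable (O ++ [(Γ ++ φ.lolli ψ :: Δ) ⊢ₛ θ])
  | sync (O : Hypersequent) (Γ Δ : List Formula) (φ ψ : Formula) :
      Derivable (O ++ [Γ ⊢ₛ φ, Δ ⊢ₛ ψ]) → Derivable (O ++ [Γ ⊢ₛ ψ, Δ ⊢ₛ φ])

/-- The `⊗`-conjunction of a sequence of formulas (the unit if the sequence is empty). -/
def bigTensor : List Formula → Formula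
  | [] => Formula.one
  | [φ] => φ
  | φ :: ψ :: Γ => φ.tensor (bigTensor (ψ :: Γ))

/-- `Γ ⊢ φ` is read as `⨂Γ ⊸ φ`, and `⊢ φ` as `φ`. -/
def Sequent.toFormula : Sequent → Formula
  | ⟨[], φ⟩ => φ
  | ⟨γ :: Γ, φ⟩ => (bigTensor (γ :: Γ)).lolli φ

/-- The conjunctive reading of a hypersequent. -/
def Hypersequent.toFormula (H : Hypersequent) : Formula :=
  bigTensor (H.map Sequent.toFormula)

/-! ### Polarized formulas and their trees -/

inductive Polarity : Type
  | pos : Polarity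
  | neg : Polarity

/-- Polarized MLL formulas: `1⁺`, `⊥⁻`, `Xᵖ`, `A ⊗ᵖ B`, `A ⅋ᵖ B`. -/
inductive PFormula : Type
  | one : PFormula
  | bot : PFormula
  | var (p : Polarity) (X : ℕ) : PFormula
  | tensor (p : Polarity) (A B : PFormula) : PFormula
  | par (p : Polarity) (A B : PFormula) : PFormula

namespace PFormula

def polarity : PFormula → Polarity
  | one => Polarity.pos
  | bot => Polarity.neg
  | var p _ => p
  | tensor p _ _ => p
  | par p _ _ => p

def IsLeaf : PFormula → Prop
  | one => True
  | bot => True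
  | var _ _ => True
  | tensor _ _ _ => False
  | par _ _ _ => False

/-- The subformula at an address of the tree of a formula; in an address `false` stands for
the left child and `true` for the right child. -/
def subAt : PFormula → List Bool → Option PFormula
  | A, [] => some A
  | tensor _ A _, false :: a => A.subAt a
  | tensor _ _ B, true :: a => B.subAt a
  | par _ A _, false :: a => A.subAt a
  | par _ _ B, true :: a => B.subAt a
  | _, _ :: _ => none

end PFormula

/-- The translation of a polarity and an IMLL formula into a polarized MLL formula. -/
def Formula.polarize : Polarity → Formula → PFormula
  | .pos, .one => .one
  | .neg, .one => .bot
  | p, .var X => .var p X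
  | .pos, .lolli φ ψ => .par .pos (polarize .neg φ) (polarize .pos ψ)
  | .neg, .lolli φ ψ => .tensor .neg (polarize .pos φ) (polarize .neg ψ)
  | .pos, .tensor φ ψ => .tensor .pos (polarize .pos φ) (polarize .pos ψ)
  | .neg, .tensor φ ψ => .par .neg (polarize .neg φ) (polarize .neg ψ)

/-! ### Nets -/

/-- The trees a net is built on: the tree of the conclusion and, for the `i`-th cut, the trees
of the two occurrences of the cut formula. -/
inductive Place : Type
  | main : Place
  | cutPos (i : ℕ) : Place
  | cutNeg (i : ℕ) : Place

/-- A node: a tree together with an address in it. -/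
structure Node : Type where
  place : Place
  addr : List Bool

/-- The left child of a node. On a `⅋⁺`-node this is the dashed child. -/
def Node.left (n : Node) : Node := ⟨n.place, n.addr ++ [false]⟩

/-- The right child of a node. -/
def Node.right (n : Node) : Node := ⟨n.place, n.addr ++ [true]⟩

/-- Points that subdivide an up-edge: a `⊥`-branch leading to the leaf `b`, or an end point of
the Amida edge with name `c`. -/
inductive Mark : Type
  | botBranch (b : Node) : Mark
  | amida (c : ℕ) : Mark

/-- The data drawn on the tree of a hypersequent. Every positive node `n` has one up-edge that
enters it from below, from its parent, from a cut, or (for the root) from nowhere;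
`track n` lists the points on this edge from bottom to top, so that they cut it
into `(track n).length + 1` up-edges. -/
structure Net : Type where
  cuts : List Formula
  axiomEdge : Node → Node → Prop
  track : Node → List Mark

namespace Net

/-- The formula at the root of one of the trees. -/
def tree (N : Net) (H : Hypersequent) : Place → Option PFormula
  | .main => some (H.toFormula.polarize .pos)
  | .cutPos i => (N.cuts[i]?).map (Formula.polarize .pos)
  | .cutNeg i => (N.cuts[i]?).map (Formula.polarize .neg)

/-- The polarized formula labelling a node (`none` if there is no such node). -/
def label (N : Net) (H : Hypersequent) (n : Node) : Option PFormula :=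
  (N.tree H n.place).bind fun A => A.subAt n.addr

def IsPositive (N : Net) (H : Hypersequent) (n : Node) : Prop :=
  ∃ A, N.label H n = some A ∧ A.polarity = .pos

/-- Essential nets: arbitrary axiom edges from positive leaves to negative leaves and
arbitrary `⊥`-branches from up-edges to `⊥⁻`-leaves are added to the trees. -/
structure IsEssential (N : Net) (H : Hypersequent) : Prop where
  axiomEdge_leaf : ∀ x y, N.axiomEdge x y → ∃ A B,
    N.label H x = some A ∧ A.IsLeaf ∧ A.polarity = .pos ∧
    N.label H y = some B ∧ B.IsLeaf ∧ B.polarity = .neg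
  track_positive : ∀ n, N.track n ≠ [] → N.IsPositive H n
  track_bot : ∀ n, ∀ k ∈ N.track n, ∃ b, k = .botBranch b ∧ N.label H b = some .bot

open Classical in
/-- Replace the points on the up-edge entering `n`. -/
noncomputable def setTrack (N : Net) (n : Node) (t : List Mark) : Net :=
  { N with track := Function.update N.track n t }

/-- The name `c` is not used by an Amida edge of the net. -/
def Fresh (N : Net) (c : ℕ) : Prop := ∀ n, Mark.amida c ∉ N.track n

end Net

/-- Amida nets of a hypersequent. Two different up-edges may be connected by a new Amida edge
(`crossApart` if they enter different nodes, `crossAlong` if they are two different pieces of the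
edge entering one node), or one up-edge may be connected with itself (`loop`). -/
inductive IsAmidaNet (H : Hypersequent) : Net → Prop
  | essential (N : Net) : N.IsEssential H → IsAmidaNet H N
  | crossApart (N : Net) (c : ℕ) (m n : Node) (s t s' t' : List Mark) :
      IsAmidaNet H N → N.Fresh c → m ≠ n → N.IsPositive H m → N.IsPositive H n →
      N.track m = s ++ t → N.track n = s' ++ t' →
      IsAmidaNet H ((N.setTrack m (s ++ .amida c :: t)).setTrack n (s' ++ .amida c :: t'))
  | crossAlong (N : Net) (c : ℕ) (n : Node) (s t u : List Mark) :
      IsAmidaNet H N → N.Fresh c → N.IsPositive H n → t ≠ [] → N.track n = s ++ t ++ u →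
      IsAmidaNet H (N.setTrack n (s ++ .amida c :: t ++ .amida c :: u))
  | loop (N : Net) (c : ℕ) (n : Node) (s u : List Mark) :
      IsAmidaNet H N → N.Fresh c → N.IsPositive H n → N.track n = s ++ u →
      IsAmidaNet H (N.setTrack n (s ++ .amida c :: .amida c :: u))

/-! ### Paths and correctness -/

/-- What a path visits: nodes, and up-edges. `upEdge n k` is the `k`-th piece, counted from the
bottom, of the edge entering the positive node `n`. -/
inductive Vertex : Type
  | node (n : Node) : Vertex
  | upEdge (n : Node) (k : ℕ) : Vertex

namespace Net

/-- One step of a path along the solid edges. Dashed edges give no step. -/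
inductive Step (N : Net) (H : Hypersequent) : Vertex → Vertex → Prop
  | tensorPosLeft (n : Node) (A B : PFormula) : N.label H n = some (.tensor .pos A B) →
      Step N H (.node n) (.upEdge n.left 0)
  | tensorPosRight (n : Node) (A B : PFormula) : N.label H n = some (.tensor .pos A B) →
      Step N H (.node n) (.upEdge n.right 0)
  | parPos (n : Node) (A B : PFormula) : N.label H n = some (.par .pos A B) →
      Step N H (.node n) (.upEdge n.right 0)
  | tensorNegUp (n : Node) (A B : PFormula) : N.label H n = some (.tensor .neg A B) →
      Step N H (.node n) (.upEdge n.left 0)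
  | tensorNegDown (n : Node) (A B : PFormula) : N.label H n = some (.tensor .neg A B) →
      Step N H (.node n.right) (.node n)
  | parNegLeft (n : Node) (A B : PFormula) : N.label H n = some (.par .neg A B) →
      Step N H (.node n.left) (.node n)
  | parNegRight (n : Node) (A B : PFormula) : N.label H n = some (.par .neg A B) →
      Step N H (.node n.right) (.node n)
  | cut (i : ℕ) : i < N.cuts.length →
      Step N H (.node ⟨.cutNeg i, []⟩) (.upEdge ⟨.cutPos i, []⟩ 0)
  | axiomEdge (x y : Node) : N.axiomEdge x y → Step N H (.node x) (.node y)
  /-- The topmost piece of an up-edge ends in its node. -/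
  | arrive (n : Node) : N.IsPositive H n →
      Step N H (.upEdge n (N.track n).length) (.node n)
  /-- At a `⊥`-branch a path goes straight on … -/
  | botStraight (n : Node) (k : ℕ) (b : Node) : (N.track n)[k]? = some (.botBranch b) →
      Step N H (.upEdge n k) (.upEdge n (k + 1))
  /-- … or turns to the `⊥⁻`-leaf. -/
  | botTurn (n : Node) (k : ℕ) (b : Node) : (N.track n)[k]? = some (.botBranch b) →
      Step N H (.upEdge n k) (.node b)
  /-- At an end of an Amida edge a path crosses to the other end and goes on upwards there. -/
  | amida (m n : Node) (j k c : ℕ) : (m, j) ≠ (n, k) →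
      (N.track m)[j]? = some (.amida c) → (N.track n)[k]? = some (.amida c) →
      Step N H (.upEdge m j) (.upEdge n (k + 1))

/-- The start of all paths from the root: the lowest piece of the edge entering the root node of
the conclusion. -/
def root : Vertex := .upEdge ⟨.main, []⟩ 0

/-- `l` is a path from the root to `v`. -/
def IsPathFromRoot (N : Net) (H : Hypersequent) (l : List Vertex) (v : Vertex) : Prop :=
  l.head? = some root ∧ l.getLast? = some v ∧ l.IsChain (N.Step H)

/-- The three correctness conditions. -/
structure Correct (N : Net) (H : Hypersequent) : Prop where
  var_pos : ∀ x X, N.label H x = some (.var .pos X) →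
    ∃ y, N.label H y = some (.var .neg X) ∧ ∀ z, N.axiomEdge x z ↔ z = y
  var_neg : ∀ y X, N.label H y = some (.var .neg X) →
    ∃ x, N.label H x = some (.var .pos X) ∧ ∀ z, N.axiomEdge z y ↔ z = x
  bot : ∀ b, N.label H b = some .bot → ∃ n, Mark.botBranch b ∈ N.track n
  one : ∀ x, N.label H x = some .one → ∀ y, ¬ N.axiomEdge x y
  acyclic : ∀ v, ¬ Relation.TransGen (N.Step H) v v
  dashed : ∀ p A B, N.label H p = some (.par .pos A B) →
    ∀ l, N.IsPathFromRoot H l (.node p.left) → Vertex.node p ∈ l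

end Net

end Amida

/-!
By (Sync), `⊢ 1 | φ ⊢ φ` becomes `⊢ φ | φ ⊢ 1`, and a component `Γ ⊢ 1` can be cut into any other
component. Hence a component `Γ ⊢ φ` may be inferred from `⊢ φ` and the components `γ ⊢ 1` with
`γ` in `Γ`, and these in turn from components `⊢ X` and `X ⊢ 1`, one for each occurrence of a
variable. Such a family of components is derivable next to `⊢ 1` as soon as every variable occurs
equally often with either sign.

The axiom edges of a correct net match the leaves `X⁺` with the leaves `X⁻`. As the two trees of a
cut carry opposite variables, the occurrences in the conclusion are balanced.
-/

namespace Amida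

/-! ### Reduction of multisets of components -/

theorem Derivable.perm_append {H H' : Hypersequent} (h : H.Perm H') :
    ∀ O : Hypersequent, Derivable (O ++ H) → Derivable (O ++ H') := by
  induction h with
  | nil => exact fun _ d => d
  | cons s _ ih => exact fun O d => by simpa using ih (O ++ [s]) (by simpa using d)
  | swap s t H =>
    exact fun O d => by
      simpa using externalExchange O H t.ctx s.ctx t.concl s.concl (by simpa using d)
  | trans _ _ ih₁ ih₂ => exact fun O d => ih₂ O (ih₁ O d)

theorem Derivable.perm {H H' : Hypersequent} (d : Derivable H) (h : H.Perm H') : Derivable H' :=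
  perm_append h [] d

/-- Derivability of a multiset of components, which is meaningful since components may be
exchanged freely. -/
def DerivableMultiset : Multiset Sequent → Prop :=
  Quotient.lift Derivable fun _ _ h => propext ⟨fun d => d.perm h, fun d => d.perm h.symm⟩

/-- `Reduces S T` says that the components `S` may be inferred from the components `T`, whatever
components stand next to them. -/
def Reduces (S T : Multiset Sequent) : Prop :=
  ∀ M, DerivableMultiset (T + M) → DerivableMultiset (S + M)

namespace Reduces

variable {S T U S' T' : Multiset Sequent}

theorem refl (S : Multiset Sequent) : Reduces S S :=
  fun _ d => d

theorem trans (h : Reduces S T) (h' : Reduces T U) : Reduces S U :=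
  fun M d => h M (h' M d)

theorem add (h : Reduces S T) (h' : Reduces S' T') : Reduces (S + S') (T + T') := by
  intro M d
  rw [add_assoc]
  refine h _ ?_
  rw [add_left_comm]
  refine h' _ ?_
  rwa [add_left_comm, ← add_assoc]

theorem of_rule {G K : Hypersequent} (h : ∀ O, Derivable (O ++ K) → Derivable (O ++ G)) :
    Reduces G K := by
  rintro ⟨O⟩ d
  exact (h O (d.perm List.perm_append_comm)).perm List.perm_append_comm

theorem of_derivable {G : Hypersequent} (d : Derivable G) : Reduces G 0 := by
  rintro ⟨O⟩ d'
  exact Derivable.merge G O d d'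

theorem list_sum_map {α : Type*} {f g : α → Multiset Sequent} (l : List α)
    (h : ∀ a, Reduces (f a) (g a)) : Reduces (l.map f).sum (l.map g).sum :=
  l.sum_hom_rel (refl 0) fun _ _ _ h' => (h _).add h'

theorem cut (Γ Δ : List Formula) (φ ψ : Formula) :
    Reduces {(Γ ++ Δ) ⊢ₛ ψ} ({Γ ⊢ₛ φ} + {(φ :: Δ) ⊢ₛ ψ}) :=
  of_rule fun O => Derivable.cut O Γ Δ φ ψ

theorem tensorR (Γ Δ : List Formula) (φ ψ : Formula) :
    Reduces {(Γ ++ Δ) ⊢ₛ φ.tensor ψ} ({Γ ⊢ₛ φ} + {Δ ⊢ₛ ψ}) :=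
  of_rule fun O => Derivable.tensorR O Γ Δ φ ψ

theorem tensorL (Γ : List Formula) (φ ψ θ : Formula) :
    Reduces {(Γ ++ [φ.tensor ψ]) ⊢ₛ θ} {(Γ ++ [φ, ψ]) ⊢ₛ θ} :=
  of_rule fun O => Derivable.tensorL O Γ φ ψ θ

theorem lolliR (Γ : List Formula) (φ ψ : Formula) :
    Reduces {Γ ⊢ₛ φ.lolli ψ} {(Γ ++ [φ]) ⊢ₛ ψ} :=
  of_rule fun O => Derivable.lolliR O Γ φ ψ

theorem lolliL (Γ Δ : List Formula) (φ ψ θ : Formula) :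
    Reduces {(Γ ++ φ.lolli ψ :: Δ) ⊢ₛ θ} ({Γ ⊢ₛ φ} + {(ψ :: Δ) ⊢ₛ θ}) :=
  of_rule fun O => Derivable.lolliL O Γ Δ φ ψ θ

theorem one_tensor (θ : Formula) : Reduces {[Formula.one.tensor θ] ⊢ₛ θ} 0 :=
  of_derivable <| .tensorL [] [] _ _ _ <| .internalExchange [] [] [] _ _ _ <|
    .oneL [] [θ] _ <| .ax θ

theorem mix (Γ Δ : List Formula) (θ : Formula) :
    Reduces {(Γ ++ Δ) ⊢ₛ θ} ({Γ ⊢ₛ Formula.one} + {Δ ⊢ₛ θ}) := by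
  have h := (cut (Γ ++ Δ) [] (Formula.one.tensor θ) θ).trans ((tensorR Γ Δ _ _).add (one_tensor θ))
  rwa [List.append_nil, add_zero] at h

end Reduces

theorem Derivable.of_reduces_zero {H : Hypersequent} (hH : H ≠ []) (h : Reduces H 0) :
    Derivable H := by
  obtain ⟨⟨Γ, φ⟩, H, rfl⟩ := List.exists_cons_of_ne_nil hH
  have d : Derivable (((Γ ⊢ₛ φ) :: H) ++ [[] ⊢ₛ Formula.one]) := h {_} .oneR
  exact Reduces.mix [] Γ φ H (d.perm List.perm_append_comm)

/-! ### Completeness for balanced hypersequents -/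

/-- A formula with a sign as a component: `⊢ φ` or `φ ⊢ 1`. -/
def literal : Polarity → Formula → Sequent
  | .pos, φ => [] ⊢ₛ φ
  | .neg, φ => [φ] ⊢ₛ Formula.one

namespace Reduces

variable (φ ψ : Formula)

theorem literal_pos_tensor :
    Reduces {literal .pos (φ.tensor ψ)} ({literal .pos φ} + {literal .pos ψ}) :=
  tensorR [] [] φ ψ

theorem literal_neg_tensor :
    Reduces {literal .neg (φ.tensor ψ)} ({literal .neg φ} + {literal .neg ψ}) :=
  (tensorL [] φ ψ _).trans (mix [φ] [ψ] _)

theorem literal_pos_lolli :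
    Reduces {literal .pos (φ.lolli ψ)} ({literal .neg φ} + {literal .pos ψ}) :=
  (lolliR [] φ ψ).trans (mix [φ] [] ψ)

theorem literal_neg_lolli :
    Reduces {literal .neg (φ.lolli ψ)} ({literal .pos φ} + {literal .neg ψ}) :=
  lolliL [] [] φ ψ _

theorem literal_pos_add_literal_neg : Reduces ({literal .pos φ} + {literal .neg φ}) 0 :=
  of_derivable (.sync [] [] [φ] _ _ (.merge [_] [_] .oneR (.ax φ)))

end Reduces

instance : DecidableEq Polarity
  | .pos, .pos => isTrue rfl
  | .neg, .neg => isTrue rfl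
  | .pos, .neg => isFalse nofun
  | .neg, .pos => isFalse nofun

/-- The occurrences of variables with polarity `p` in a polarized formula. -/
def PFormula.vars (p : Polarity) : PFormula → Multiset ℕ
  | .one => 0
  | .bot => 0
  | .var q X => if q = p then {X} else 0
  | .tensor _ A B => A.vars p + B.vars p
  | .par _ A B => A.vars p + B.vars p

/-- A polarized formula is balanced if every variable occurs equally often with either polarity. -/
def PFormula.Balanced (A : PFormula) : Prop :=
  A.vars .pos = A.vars .neg

/-- The components `⊢ X` and `X ⊢ 1` for the occurrences of `X⁺` and `X⁻` in a polarized formula. -/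
def PFormula.atoms (A : PFormula) : Multiset Sequent :=
  (A.vars .pos).map (fun X => literal .pos (.var X)) +
    (A.vars .neg).map fun X => literal .neg (.var X)

namespace PFormula

theorem atoms_var (p : Polarity) (X : ℕ) : (var p X).atoms = {literal p (.var X)} := by
  cases p <;> rfl

theorem atoms_tensor (p : Polarity) (A B : PFormula) :
    (tensor p A B).atoms = A.atoms + B.atoms := by
  simp only [atoms, vars, Multiset.map_add, add_add_add_comm]

theorem atoms_par (p : Polarity) (A B : PFormula) : (par p A B).atoms = A.atoms + B.atoms :=
  atoms_tensor p A B

theorem Balanced.reduces_atoms_zero {A : PFormula} (hA : A.Balanced) : Reduces A.atoms 0 := by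
  rw [atoms, show A.vars .pos = A.vars .neg from hA]
  induction A.vars .neg using Multiset.induction with
  | empty => exact .refl 0
  | cons X V ih =>
    simp only [← Multiset.singleton_add, Multiset.map_add, Multiset.map_singleton]
    rw [add_add_add_comm]
    exact (Reduces.literal_pos_add_literal_neg _).add ih

end PFormula

theorem literal_reduces_atoms (p : Polarity) (φ : Formula) :
    Reduces {literal p φ} (φ.polarize p).atoms := by
  induction φ generalizing p with
  | one =>
    cases p
    · exact .of_derivable .oneR
    · exact .of_derivable (.ax _)
  | var X => cases p <;> exact PFormula.atoms_var _ X ▸ .refl _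
  | tensor φ ψ ihφ ihψ =>
    cases p
    · exact (Reduces.literal_pos_tensor φ ψ).trans
        (PFormula.atoms_tensor _ _ _ ▸ (ihφ .pos).add (ihψ .pos))
    · exact (Reduces.literal_neg_tensor φ ψ).trans
        (PFormula.atoms_par _ _ _ ▸ (ihφ .neg).add (ihψ .neg))
  | lolli φ ψ ihφ ihψ =>
    cases p
    · exact (Reduces.literal_pos_lolli φ ψ).trans
        (PFormula.atoms_par _ _ _ ▸ (ihφ .neg).add (ihψ .pos))
    · exact (Reduces.literal_neg_lolli φ ψ).trans
        (PFormula.atoms_tensor _ _ _ ▸ (ihφ .pos).add (ihψ .neg))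

theorem atoms_bigTensor (p : Polarity) (Γ : List Formula) :
    ((bigTensor Γ).polarize p).atoms = (Γ.map fun φ => (φ.polarize p).atoms).sum := by
  induction Γ using bigTensor.induct with
  | case1 => cases p <;> rfl
  | case2 φ => simp [bigTensor]
  | case3 φ ψ Γ ih =>
    rw [List.map_cons, List.sum_cons, ← ih]
    cases p
    · exact PFormula.atoms_tensor _ _ _
    · exact PFormula.atoms_par _ _ _

namespace Sequent

theorem reduces_literals (Γ : List Formula) (φ : Formula) :
    Reduces {Γ ⊢ₛ φ} ((Γ.map fun γ => {literal .neg γ}).sum + {literal .pos φ}) := by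
  induction Γ with
  | nil => exact .refl _
  | cons γ Γ ih =>
    rw [List.map_cons, List.sum_cons, add_assoc]
    exact (Reduces.mix [γ] Γ φ).trans ((Reduces.refl _).add ih)

theorem reduces_atoms (s : Sequent) : Reduces {s} (s.toFormula.polarize .pos).atoms := by
  obtain ⟨_ | ⟨γ, Γ⟩, φ⟩ := s
  · exact literal_reduces_atoms .pos φ
  · refine (reduces_literals (γ :: Γ) φ).trans ?_
    have hatoms : ((Sequent.mk (γ :: Γ) φ).toFormula.polarize .pos).atoms =
        ((γ :: Γ).map fun γ => (γ.polarize .neg).atoms).sum + (φ.polarize .pos).atoms := by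
      rw [← atoms_bigTensor]
      exact PFormula.atoms_par _ _ _
    rw [hatoms]
    exact (Reduces.list_sum_map _ (literal_reduces_atoms .neg)).add (literal_reduces_atoms .pos φ)

end Sequent

theorem Hypersequent.reduces_atoms (H : Hypersequent) :
    Reduces H (H.toFormula.polarize .pos).atoms := by
  have hH : (H : Multiset Sequent) = (H.map fun s => {s}).sum := by
    rw [← Multiset.sum_coe, ← Multiset.map_coe, Multiset.sum_map_singleton]
  rw [Hypersequent.toFormula, atoms_bigTensor, List.map_map, hH]
  exact Reduces.list_sum_map H Sequent.reduces_atoms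

theorem Derivable.of_balanced {H : Hypersequent} (hH : H ≠ [])
    (h : (H.toFormula.polarize .pos).Balanced) : Derivable H :=
  of_reduces_zero hH (H.reduces_atoms.trans h.reduces_atoms_zero)

/-! ### Counting the leaves of a net -/

theorem Formula.vars_polarize_pos_add_vars_polarize_neg (φ : Formula) :
    (φ.polarize .pos).vars .pos + (φ.polarize .neg).vars .pos =
      (φ.polarize .pos).vars .neg + (φ.polarize .neg).vars .neg := by
  induction φ with
  | one => rfl
  | var X => simp [polarize, PFormula.vars]
  | tensor φ ψ ihφ ihψ =>
    simp only [polarize, PFormula.vars]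
    rw [add_add_add_comm, ihφ, ihψ, add_add_add_comm]
  | lolli φ ψ ihφ ihψ =>
    simp only [polarize, PFormula.vars]
    rw [add_add_add_comm, add_comm ((φ.polarize .neg).vars .pos), ihφ, ihψ,
      add_comm ((φ.polarize .pos).vars .neg), add_add_add_comm]

/-- The addresses of the leaves of a polarized formula that are labelled with `Xᵖ`. -/
def PFormula.leaves (A : PFormula) (p : Polarity) (X : ℕ) : Set (List Bool) :=
  {a | A.subAt a = some (.var p X)}

namespace PFormula

variable (p q : Polarity) (X Y : ℕ) (A B : PFormula)

theorem leaves_one : one.leaves p X = ∅ := by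
  ext (_ | _) <;> simp [leaves, subAt]

theorem leaves_bot : bot.leaves p X = ∅ := by
  ext (_ | _) <;> simp [leaves, subAt]

theorem leaves_var : (var q Y).leaves p X = if q = p ∧ Y = X then {[]} else ∅ := by
  ext (_ | _) <;> split_ifs <;> simp_all [leaves, subAt]

theorem leaves_tensor : (tensor q A B).leaves p X =
    (false :: ·) '' A.leaves p X ∪ (true :: ·) '' B.leaves p X := by
  ext (_ | ⟨_ | _, _⟩) <;> simp [leaves, subAt]

theorem leaves_par : (par q A B).leaves p X =
    (false :: ·) '' A.leaves p X ∪ (true :: ·) '' B.leaves p X := by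
  ext (_ | ⟨_ | _, _⟩) <;> simp [leaves, subAt]

end PFormula

theorem encard_image_cons_union_image_cons {α : Type*} {a b : α} (hab : a ≠ b)
    (s t : Set (List α)) : ((a :: ·) '' s ∪ (b :: ·) '' t).encard = s.encard + t.encard := by
  have hdisj : Disjoint ((a :: ·) '' s) ((b :: ·) '' t) :=
    Set.disjoint_image_image fun _ _ _ _ h => hab (List.cons.inj h).1
  rw [Set.encard_union_eq hdisj, List.cons_injective.encard_image, List.cons_injective.encard_image]

theorem PFormula.encard_leaves (A : PFormula) (p : Polarity) (X : ℕ) :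
    (A.leaves p X).encard = (A.vars p).count X := by
  induction A with
  | one => simp [leaves_one, vars]
  | bot => simp [leaves_bot, vars]
  | var q Y =>
    by_cases hq : q = p <;> by_cases hY : X = Y <;>
      simp [leaves_var, vars, hq, hY, Ne.symm]
  | tensor q A B ihA ihB =>
    simp [leaves_tensor, vars, encard_image_cons_union_image_cons, ihA, ihB]
  | par q A B ihA ihB =>
    simp [leaves_par, vars, encard_image_cons_union_image_cons, ihA, ihB]

theorem encard_eq_encard_of_rel {α β : Type*} {s : Set α} {t : Set β} (r : α → β → Prop)
    (hs : ∀ x ∈ s, ∃ y ∈ t, ∀ z, r x z ↔ z = y) (ht : ∀ y ∈ t, ∃ x ∈ s, ∀ z, r z y ↔ z = x) :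
    s.encard = t.encard := by
  choose f hft hf using hs
  choose g hgs hg using ht
  refine Set.encard_congr ⟨fun x => ⟨f x x.2, hft x x.2⟩, fun y => ⟨g y y.2, hgs y y.2⟩, ?_, ?_⟩
  · exact fun x => Subtype.ext ((hg _ _ _).1 ((hf x x.2 _).2 rfl)).symm
  · exact fun y => Subtype.ext ((hf _ _ _).1 ((hg y y.2 _).2 rfl)).symm

namespace Net

variable (N : Net) (H : Hypersequent) (p : Polarity) (X : ℕ)

/-- The leaves of a net that are labelled with `Xᵖ`. -/
def leaves : Set Node :=
  {x | N.label H x = some (.var p X)}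

theorem leaves_eq : N.leaves H p X =
    Node.mk .main '' (H.toFormula.polarize .pos).leaves p X ∪
      ⋃ i : Fin N.cuts.length, (Node.mk (.cutPos i) '' (N.cuts[i].polarize .pos).leaves p X ∪
        Node.mk (.cutNeg i) '' (N.cuts[i].polarize .neg).leaves p X) := by
  ext ⟨_ | i | i, a⟩ <;>
    simp [leaves, PFormula.leaves, label, tree, Fin.exists_iff, Option.bind_eq_some_iff,
      List.getElem?_eq_some_iff]

/-- The occurrences of variables with polarity `p` in all trees of a net. -/
def vars : Multiset ℕ :=
  (H.toFormula.polarize .pos).vars p + ∑ i : Fin N.cuts.length,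
    ((N.cuts[i].polarize .pos).vars p + (N.cuts[i].polarize .neg).vars p)

theorem encard_leaves : (N.leaves H p X).encard = (N.vars H p).count X := by
  have mk_injective (P : Place) : Function.Injective (Node.mk P) := fun _ _ h => (Node.mk.inj h).2
  have mk_disjoint {P Q : Place} (hPQ : P ≠ Q) (s t : Set (List Bool)) :
      Disjoint (Node.mk P '' s) (Node.mk Q '' t) :=
    Set.disjoint_image_image fun _ _ _ _ h => hPQ (Node.mk.inj h).1
  rw [leaves_eq, Set.encard_union_eq, Set.encard_iUnion_of_finite]
  · simp [vars, (mk_injective _).encard_image, PFormula.encard_leaves, mk_disjoint,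
      Set.encard_union_eq, finsum_eq_sum_of_fintype, Multiset.count_sum']
  · intro i j hij
    have hij' : (i : ℕ) ≠ j := by simpa [Fin.ext_iff] using hij
    simp [Function.onFun, mk_disjoint, hij']
  · simp [mk_disjoint]

variable {N H}

theorem balanced_of_encard_leaves_eq
    (h : ∀ X, (N.leaves H .pos X).encard = (N.leaves H .neg X).encard) :
    (H.toFormula.polarize .pos).Balanced := by
  have hvars : N.vars H .pos = N.vars H .neg := by
    ext X
    exact_mod_cast (N.encard_leaves H .pos X) ▸ (N.encard_leaves H .neg X) ▸ h X
  rw [vars, vars] at hvars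
  simp only [Formula.vars_polarize_pos_add_vars_polarize_neg] at hvars
  exact add_right_cancel hvars

end Net

end Amida

open Amida in
theorem mainTheorem9_general (H : Hypersequent) (hH : H ≠ []) (N : Net)
    (var_pos : ∀ x X, N.label H x = some (.var .pos X) →
      ∃ y, N.label H y = some (.var .neg X) ∧ ∀ z, N.axiomEdge x z ↔ z = y)
    (var_neg : ∀ y X, N.label H y = some (.var .neg X) →
      ∃ x, N.label H x = some (.var .pos X) ∧ ∀ z, N.axiomEdge z y ↔ z = x) :
    Derivable H :=
  Derivable.of_balanced hH <| Net.balanced_of_encard_leaves_eq fun X =>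
    encard_eq_encard_of_rel N.axiomEdge (fun x => var_pos x X) fun y => var_neg y X

theorem mainTheorem9 (H : Amida.Hypersequent) (hH : H ≠ [])
    (h : ∃ N : Amida.Net, Amida.IsAmidaNet H N ∧ N.Correct H) :
    Amida.Derivable H := by
  obtain ⟨N, -, hN⟩ := h
  exact mainTheorem9_general H hH N hN.var_pos hN.var_neg
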